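/- Let $\mathbb{F}$ be a finite field with $q$ elements, let $\psi\colon \mathbb{F}\to\mathbb{C}^\times$ be a non-trivial additive character, let $k\ge 1$, and let $\alpha=(\alpha_1,\dots,\alpha_k)$, where $\alpha_1,\dots,\alpha_k\colon\mathbb{F}^\times\to\mathbb{C}^\times$ are multiplicative characters. For $c\ge 0$ and $h\in \mathrm{GL}_c(\mathbb{F})$ define the twisted matrix Kloosterman sum $$K(\alpha,\psi,h)=\sum_{\substack{x_1,\dots,x_k\in \mathrm{GL}_c(\mathbb{F})\\ x_1 x_2\cdots x_k=h}}\Bigl(\prod_{j=1}^k\alpha_j(\det x_j)\Bigr)\,\psi\Bigl(\sum_{j=1}^k\operatorname{tr} x_j\Bigr).$$ Let $c_1,c_2\ge 0$, let $h_1\in \mathrm{GL}_{c_1}(\mathbb{F})$ and $h_2\in \mathrm{GL}_{c_2}(\mathbb{F})$, and let $$N_{(c_1,c_2)}=\left\{\begin{pmatrix} I_{c_1} & X\\ 0 & I_{c_2}\end{pmatrix} : X\in \mathrm{Mat}_{c_1\times c_2}(\mathbb{F})\right\}\subseteq \mathrm{GL}_{c_1+c_2}(\mathbb{F}).$$ Then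 $$\sum_{n\in N_{(c_1,c_2)}}K\bigl(\alpha,\psi,n\,\mathrm{diag}(h_1,h_2)\bigr)=q^{kc_1c_2}\,K(\alpha,\psi,h_1)\,K(\alpha,\psi,h_2).$$ Moreover, if $h_1$ and $h_2$ have no common eigenvalue in an algebraic closure $\overline{\mathbb{F}}$, then $$K\bigl(\alpha,\psi,\mathrm{diag}(h_1,h_2)\bigr)=q^{(k-1)c_1c_2}\,K(\alpha,\psi,h_1)\,K(\alpha,\psi,h_2).$$ -/

import Mathlib

open scoped MatrixGroups

/-- The twisted matrix Kloosterman sum attached to characters `α 0, …, α (k - 1)` of `Fˣ`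
and an additive character `ψ` of the finite field `F`, evaluated at `h ∈ GL_c(F)`. The product
`x 0 * x 1 * ⋯ * x (k - 1)` is taken in this order. -/
noncomputable def twistedMatrixKloosterman {F : Type*} [Field F] [Fintype F] [DecidableEq F]
    {k c : ℕ} (α : Fin k → (Fˣ →* ℂˣ)) (ψ : AddChar F ℂ) (h : GL (Fin c) F) : ℂ :=
  ∑ x : Fin k → GL (Fin c) F with (List.ofFn x).prod = h,
    (∏ j, (α j (Matrix.GeneralLinearGroup.det (x j)) : ℂ)) *
      ψ (∑ j, Matrix.trace (x j : Matrix (Fin c) (Fin c) F))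

/-- The `(c₁ + c₂) × (c₁ + c₂)` matrix with blocks `A B; C D`, where `A` is `c₁ × c₁` and
`D` is `c₂ × c₂`. -/
def blockMatrix {F : Type*} {c₁ c₂ : ℕ}
    (A : Matrix (Fin c₁) (Fin c₁) F) (B : Matrix (Fin c₁) (Fin c₂) F)
    (C : Matrix (Fin c₂) (Fin c₁) F) (D : Matrix (Fin c₂) (Fin c₂) F) :
    Matrix (Fin (c₁ + c₂)) (Fin (c₁ + c₂)) F :=
  (Matrix.fromBlocks A B C D).submatrix finSumFinEquiv.symm finSumFinEquiv.symm

theorem blockMatrix_mul {F : Type*} [Field F] {c₁ c₂ : ℕ}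
    (A A' : Matrix (Fin c₁) (Fin c₁) F) (B B' : Matrix (Fin c₁) (Fin c₂) F)
    (C C' : Matrix (Fin c₂) (Fin c₁) F) (D D' : Matrix (Fin c₂) (Fin c₂) F) :
    blockMatrix A B C D * blockMatrix A' B' C' D' =
      blockMatrix (A * A' + B * C') (A * B' + B * D') (C * A' + D * C') (C * B' + D * D') := by
  simp only [blockMatrix, Matrix.submatrix_mul_equiv, Matrix.fromBlocks_multiply]

theorem blockMatrix_one {F : Type*} [Field F] {c₁ c₂ : ℕ} :
    blockMatrix (1 : Matrix (Fin c₁) (Fin c₁) F) 0 0 (1 : Matrix (Fin c₂) (Fin c₂) F) = 1 := by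
  simp only [blockMatrix, Matrix.fromBlocks_one, Matrix.submatrix_one_equiv]

/-- The block diagonal matrix `diag(h₁, h₂)` as an element of `GL_{c₁ + c₂}(F)`. -/
def diagGL {F : Type*} [Field F] {c₁ c₂ : ℕ} (h₁ : GL (Fin c₁) F) (h₂ : GL (Fin c₂) F) :
    GL (Fin (c₁ + c₂)) F where
  val := blockMatrix h₁.val 0 0 h₂.val
  inv := blockMatrix h₁.inv 0 0 h₂.inv
  val_inv := by
    rw [blockMatrix_mul, h₁.val_inv, h₂.val_inv]
    simpa using blockMatrix_one
  inv_val := by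
    rw [blockMatrix_mul, h₁.inv_val, h₂.inv_val]
    simpa using blockMatrix_one

/-- The subgroup `N_{(c₁, c₂)}` of `GL_{c₁ + c₂}(F)` of all matrices `1 X; 0 1` with `X` an
arbitrary `c₁ × c₂` matrix. -/
def unipotentRadical (F : Type*) [Field F] (c₁ c₂ : ℕ) : Subgroup (GL (Fin (c₁ + c₂)) F) where
  carrier := {n | ∃ X : Matrix (Fin c₁) (Fin c₂) F,
    (n : Matrix (Fin (c₁ + c₂)) (Fin (c₁ + c₂)) F) = blockMatrix 1 X 0 1}
  one_mem' := ⟨0, by simpa using blockMatrix_one.symm⟩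
  mul_mem' := by
    rintro a b ⟨X, hX⟩ ⟨Y, hY⟩
    exact ⟨Y + X, by rw [Units.val_mul, hX, hY, blockMatrix_mul]; simp⟩
  inv_mem' := by
    rintro a ⟨X, hX⟩
    refine ⟨-X, ?_⟩
    rw [← Units.mul_eq_one_iff_inv_eq, hX, blockMatrix_mul]
    simpa using blockMatrix_one

/-- The square matrices `A` and `B` over `F` have a common eigenvalue in the algebraic closure
of `F`. -/
def HaveCommonEigenvalue {F : Type*} [Field F] {c₁ c₂ : ℕ}
    (A : Matrix (Fin c₁) (Fin c₁) F) (B : Matrix (Fin c₂) (Fin c₂) F) : Prop :=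
  ∃ μ : AlgebraicClosure F,
    Module.End.HasEigenvalue
      (Matrix.toLin' (A.map (algebraMap F (AlgebraicClosure F)))) μ ∧
    Module.End.HasEigenvalue
      (Matrix.toLin' (B.map (algebraMap F (AlgebraicClosure F)))) μ

/-! Write `φ(x) = α(det x) ψ(tr x)` and `u(X)` for the unipotent block matrix. The Kloosterman sum
is an iterated convolution of such class functions, hence itself a class function. So the coset sum
`U(g) = ∑_X K(g u(X))` is also invariant under `g ↦ u(Y) g`, and in the convolution recursion for
`U` each `φ(x)` may be averaged over `x u(Y)`. If `C` is the lower left block of `x`, this average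
contains `∑_Y ψ(tr(C Y))`, which vanishes unless `C = 0`. Only block upper triangular `x` survive;
there `φ` is the product of its values on the diagonal blocks, so the recursion splits into those
for `h₁` and `h₂` (`unipotentSum_diagGL`). Without common eigenvalues the Sylvester map `X ↦ h₁ X -
X h₂` is bijective, so every element of the coset is conjugate to `diag(h₁, h₂)` and the coset sum
has equal terms. -/

/-! ### Kloosterman sums as convolutions of class functions -/

/-- The summand of the Kloosterman sum attached to a single factor. -/
noncomputable def kloostermanFactor {F : Type*} [Field F] {c : ℕ} (χ : Fˣ →* ℂˣ)
    (ψ : AddChar F ℂ) (x : GL (Fin c) F) : ℂ :=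
  (χ (Matrix.GeneralLinearGroup.det x) : ℂ) * ψ (Matrix.trace (x : Matrix (Fin c) (Fin c) F))

theorem kloostermanFactor_mul_comm {F : Type*} [Field F] {c : ℕ} (χ : Fˣ →* ℂˣ)
    (ψ : AddChar F ℂ) (x y : GL (Fin c) F) :
    kloostermanFactor χ ψ (x * y) = kloostermanFactor χ ψ (y * x) := by
  rw [kloostermanFactor, kloostermanFactor, Units.val_mul, Units.val_mul, Matrix.trace_mul_comm,
    map_mul Matrix.GeneralLinearGroup.det, map_mul Matrix.GeneralLinearGroup.det,
    mul_comm (Matrix.GeneralLinearGroup.det x)]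

theorem twistedMatrixKloosterman_zero {F : Type*} [Field F] [Fintype F] [DecidableEq F] {c : ℕ}
    (α : Fin 0 → (Fˣ →* ℂˣ)) (ψ : AddChar F ℂ) (h : GL (Fin c) F) :
    twistedMatrixKloosterman α ψ h = if h = 1 then 1 else 0 := by
  rw [twistedMatrixKloosterman, Finset.sum_filter]
  simp [eq_comm]

theorem twistedMatrixKloosterman_succ {F : Type*} [Field F] [Fintype F] [DecidableEq F]
    {k c : ℕ} (α : Fin (k + 1) → (Fˣ →* ℂˣ)) (ψ : AddChar F ℂ) (h : GL (Fin c) F) :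
    twistedMatrixKloosterman α ψ h =
      ∑ x, kloostermanFactor (α 0) ψ x *
        twistedMatrixKloosterman (fun j => α j.succ) ψ (x⁻¹ * h) := by
  simp only [twistedMatrixKloosterman, Finset.sum_filter]
  rw [← (Fin.consEquiv (fun _ : Fin (k + 1) => GL (Fin c) F)).sum_comp, Fintype.sum_prod_type]
  refine Finset.sum_congr rfl fun x _ => ?_
  rw [Finset.mul_sum]
  refine Finset.sum_congr rfl fun y _ => ?_
  simp only [Fin.consEquiv_apply, List.ofFn_succ, Fin.cons_zero, Fin.cons_succ, List.prod_cons,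
    Fin.prod_univ_succ, Fin.sum_univ_succ, AddChar.map_add_eq_mul, eq_inv_mul_iff_mul_eq,
    mul_ite, mul_zero, kloostermanFactor]
  split_ifs <;> ring

/-- Convolution preserves class functions: substitute `g x g⁻¹` for the first variable and induct.
-/
theorem twistedMatrixKloosterman_mul_comm {F : Type*} [Field F] [Fintype F] [DecidableEq F]
    {k c : ℕ} (α : Fin k → (Fˣ →* ℂˣ)) (ψ : AddChar F ℂ) (g h : GL (Fin c) F) :
    twistedMatrixKloosterman α ψ (g * h) = twistedMatrixKloosterman α ψ (h * g) := by
  induction k generalizing g h with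
  | zero => simp only [twistedMatrixKloosterman_zero, mul_eq_one_comm]
  | succ k ih =>
    rw [twistedMatrixKloosterman_succ, twistedMatrixKloosterman_succ,
      ← (MulAut.conj g).toEquiv.sum_comp]
    refine Finset.sum_congr rfl fun x _ => ?_
    simp only [MulEquiv.toEquiv_eq_coe, MulEquiv.coe_toEquiv, MulAut.conj_apply]
    rw [kloostermanFactor_mul_comm, inv_mul_cancel_left,
      show (g * x * g⁻¹)⁻¹ * (g * h) = g * (x⁻¹ * h) by group, ih, mul_assoc]

/-! ### The block upper triangular subgroup and its factorisation -/

/-- The unipotent block matrix `1 X; 0 1`. -/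
def unipotentGL {F : Type*} [Field F] {c₁ c₂ : ℕ} (X : Matrix (Fin c₁) (Fin c₂) F) :
    GL (Fin (c₁ + c₂)) F where
  val := blockMatrix 1 X 0 1
  inv := blockMatrix 1 (-X) 0 1
  val_inv := by rw [blockMatrix_mul]; simpa using blockMatrix_one
  inv_val := by rw [blockMatrix_mul]; simpa using blockMatrix_one

theorem unipotentGL_val {F : Type*} [Field F] {c₁ c₂ : ℕ} (X : Matrix (Fin c₁) (Fin c₂) F) :
    (unipotentGL X : Matrix (Fin (c₁ + c₂)) (Fin (c₁ + c₂)) F) = blockMatrix 1 X 0 1 := rfl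

theorem diagGL_val {F : Type*} [Field F] {c₁ c₂ : ℕ} (a : GL (Fin c₁) F) (b : GL (Fin c₂) F) :
    (diagGL a b : Matrix (Fin (c₁ + c₂)) (Fin (c₁ + c₂)) F) = blockMatrix a.val 0 0 b.val := rfl

theorem blockMatrix_inj {F : Type*} {c₁ c₂ : ℕ}
    {A A' : Matrix (Fin c₁) (Fin c₁) F} {B B' : Matrix (Fin c₁) (Fin c₂) F}
    {C C' : Matrix (Fin c₂) (Fin c₁) F} {D D' : Matrix (Fin c₂) (Fin c₂) F} :
    blockMatrix A B C D = blockMatrix A' B' C' D' ↔ A = A' ∧ B = B' ∧ C = C' ∧ D = D' := by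
  rw [← Matrix.fromBlocks_inj]
  exact (Matrix.reindex finSumFinEquiv finSumFinEquiv).injective.eq_iff

theorem exists_eq_blockMatrix {F : Type*} {c₁ c₂ : ℕ}
    (M : Matrix (Fin (c₁ + c₂)) (Fin (c₁ + c₂)) F) :
    ∃ A B C D, M = (blockMatrix A B C D : Matrix (Fin (c₁ + c₂)) (Fin (c₁ + c₂)) F) := by
  obtain ⟨N, rfl⟩ := (Matrix.reindex finSumFinEquiv finSumFinEquiv).surjective M
  exact ⟨_, _, _, _, congrArg _ (Matrix.fromBlocks_toBlocks N).symm⟩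

theorem trace_blockMatrix {F : Type*} [Field F] {c₁ c₂ : ℕ}
    (A : Matrix (Fin c₁) (Fin c₁) F) (B : Matrix (Fin c₁) (Fin c₂) F)
    (C : Matrix (Fin c₂) (Fin c₁) F) (D : Matrix (Fin c₂) (Fin c₂) F) :
    (blockMatrix A B C D).trace = A.trace + D.trace := by
  refine (Equiv.sum_comp finSumFinEquiv.symm (Matrix.fromBlocks A B C D).diag).trans ?_
  simp [Matrix.trace, Fintype.sum_sum_type]

theorem det_blockMatrix_zero {F : Type*} [Field F] {c₁ c₂ : ℕ}
    (A : Matrix (Fin c₁) (Fin c₁) F) (B : Matrix (Fin c₁) (Fin c₂) F)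
    (D : Matrix (Fin c₂) (Fin c₂) F) :
    (blockMatrix A B 0 D).det = A.det * D.det := by
  rw [blockMatrix, Matrix.det_submatrix_equiv_self, Matrix.det_fromBlocks_zero₂₁]

theorem unipotentGL_mul {F : Type*} [Field F] {c₁ c₂ : ℕ} (X Y : Matrix (Fin c₁) (Fin c₂) F) :
    unipotentGL X * unipotentGL Y = unipotentGL (X + Y) := by
  apply Units.ext
  rw [Units.val_mul]
  simp only [unipotentGL_val, blockMatrix_mul]
  simp [add_comm]

theorem unipotentGL_inv {F : Type*} [Field F] {c₁ c₂ : ℕ} (X : Matrix (Fin c₁) (Fin c₂) F) :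
    (unipotentGL X)⁻¹ = unipotentGL (-X) := by
  rw [inv_eq_iff_mul_eq_one, unipotentGL_mul]
  exact Units.ext (by simpa [unipotentGL_val] using blockMatrix_one)

theorem diagGL_mul {F : Type*} [Field F] {c₁ c₂ : ℕ} (a a' : GL (Fin c₁) F)
    (b b' : GL (Fin c₂) F) : diagGL a b * diagGL a' b' = diagGL (a * a') (b * b') := by
  apply Units.ext
  rw [Units.val_mul]
  simp only [diagGL_val, blockMatrix_mul]
  simp

theorem diagGL_one {F : Type*} [Field F] {c₁ c₂ : ℕ} :
    diagGL (1 : GL (Fin c₁) F) (1 : GL (Fin c₂) F) = 1 :=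
  Units.ext blockMatrix_one

theorem diagGL_inv {F : Type*} [Field F] {c₁ c₂ : ℕ} (a : GL (Fin c₁) F) (b : GL (Fin c₂) F) :
    (diagGL a b)⁻¹ = diagGL a⁻¹ b⁻¹ := by
  rw [inv_eq_iff_mul_eq_one, diagGL_mul, mul_inv_cancel, mul_inv_cancel, diagGL_one]

theorem diagGL_mul_unipotentGL_eq_one {F : Type*} [Field F] {c₁ c₂ : ℕ} (a : GL (Fin c₁) F)
    (b : GL (Fin c₂) F) (X : Matrix (Fin c₁) (Fin c₂) F) :
    diagGL a b * unipotentGL X = 1 ↔ X = 0 ∧ a = 1 ∧ b = 1 := by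
  rw [← Units.val_inj, Units.val_mul, diagGL_val, unipotentGL_val, blockMatrix_mul, Units.val_one,
    ← blockMatrix_one, blockMatrix_inj]
  simp only [mul_one, add_zero, Matrix.mul_one, Matrix.mul_zero,
    Matrix.zero_mul, zero_add, true_and, Units.val_eq_one]
  constructor
  · rintro ⟨rfl, h, rfl⟩
    exact ⟨by simpa using h, rfl, rfl⟩
  · rintro ⟨rfl, rfl, rfl⟩
    simp

theorem kloostermanFactor_diagGL_mul_unipotentGL {F : Type*} [Field F] {c₁ c₂ : ℕ}
    (χ : Fˣ →* ℂˣ) (ψ : AddChar F ℂ) (a : GL (Fin c₁) F) (b : GL (Fin c₂) F)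
    (X : Matrix (Fin c₁) (Fin c₂) F) :
    kloostermanFactor χ ψ (diagGL a b * unipotentGL X) =
      kloostermanFactor χ ψ a * kloostermanFactor χ ψ b := by
  have hv : ((diagGL a b * unipotentGL X : GL (Fin (c₁ + c₂)) F) :
      Matrix (Fin (c₁ + c₂)) (Fin (c₁ + c₂)) F) = blockMatrix a.val (a.val * X) 0 b.val := by
    rw [Units.val_mul, diagGL_val, unipotentGL_val, blockMatrix_mul]
    simp
  have hdet : Matrix.GeneralLinearGroup.det (diagGL a b * unipotentGL X) =
      Matrix.GeneralLinearGroup.det a * Matrix.GeneralLinearGroup.det b := by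
    apply Units.ext
    rw [Units.val_mul]
    simp only [Matrix.GeneralLinearGroup.val_det_apply, hv, det_blockMatrix_zero]
  rw [kloostermanFactor, hdet, hv, trace_blockMatrix, AddChar.map_add_eq_mul, map_mul,
    Units.val_mul, kloostermanFactor, kloostermanFactor]
  ring

/-- An element of `GL` with vanishing lower left block has the form `diag(a, b) * (1 X; 0 1)`. -/
theorem exists_eq_diagGL_mul_unipotentGL {F : Type*} [Field F] {c₁ c₂ : ℕ}
    (x : GL (Fin (c₁ + c₂)) F) (A : Matrix (Fin c₁) (Fin c₁) F) (B : Matrix (Fin c₁) (Fin c₂) F)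
    (D : Matrix (Fin c₂) (Fin c₂) F)
    (hx : (x : Matrix (Fin (c₁ + c₂)) (Fin (c₁ + c₂)) F) = blockMatrix A B 0 D) :
    ∃ a b X, x = diagGL a b * unipotentGL X := by
  have hu : IsUnit (blockMatrix A B 0 D).det := by
    rw [← hx]; exact (Matrix.isUnit_iff_isUnit_det _).1 x.isUnit
  rw [det_blockMatrix_zero, IsUnit.mul_iff, ← Matrix.isUnit_iff_isUnit_det,
    ← Matrix.isUnit_iff_isUnit_det] at hu
  obtain ⟨⟨a, rfl⟩, ⟨b, rfl⟩⟩ := hu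
  refine ⟨a, b, a.inv * B, Units.ext ?_⟩
  rw [hx, Units.val_mul, diagGL_val, unipotentGL_val, blockMatrix_mul]
  simp [← Matrix.mul_assoc]

/-- Uniqueness of the factorisation lets a sum over the block upper triangular subgroup run over
triples `(a, b, X)`. -/
theorem diagGL_mul_unipotentGL_injective {F : Type*} [Field F] {c₁ c₂ : ℕ} :
    Function.Injective fun p : GL (Fin c₁) F × GL (Fin c₂) F × Matrix (Fin c₁) (Fin c₂) F =>
      diagGL p.1 p.2.1 * unipotentGL p.2.2 := by
  rintro ⟨a, b, X⟩ ⟨a', b', X'⟩ h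
  have h' : diagGL (a'⁻¹ * a) (b'⁻¹ * b) * unipotentGL (X - X') = 1 := by
    rw [← diagGL_mul, ← diagGL_inv, sub_eq_add_neg, ← unipotentGL_mul, ← unipotentGL_inv]
    rw [show (diagGL a' b')⁻¹ * diagGL a b * (unipotentGL X * (unipotentGL X')⁻¹) =
      (diagGL a' b')⁻¹ * (diagGL a b * unipotentGL X) * (unipotentGL X')⁻¹ by group]
    rw [show diagGL a b * unipotentGL X = diagGL a' b' * unipotentGL X' from h]
    group
  rw [diagGL_mul_unipotentGL_eq_one, inv_mul_eq_one, inv_mul_eq_one, sub_eq_zero] at h'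
  simp [h'.1, h'.2.1, h'.2.2]

/-! ### Character sums and averages over the unipotent radical -/

/-- The trace pairing is nondegenerate, so `X ↦ ψ(tr(C X))` is a nontrivial character. -/
theorem sum_addChar_trace_mul {F : Type*} [Field F] [Fintype F] {m n : ℕ}
    {ψ : AddChar F ℂ} (hψ : ψ ≠ 1) (C : Matrix (Fin n) (Fin m) F) (hC : C ≠ 0) :
    ∑ X : Matrix (Fin m) (Fin n) F, ψ (C * X).trace = 0 := by
  let φ : AddChar (Matrix (Fin m) (Fin n) F) ℂ := ψ.compAddMonoidHom
    { toFun := fun X => (C * X).trace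
      map_zero' := by simp
      map_add' := fun X Y => by rw [Matrix.mul_add, Matrix.trace_add] }
  refine (AddChar.sum_eq_zero_iff_ne_zero (ψ := φ)).2 fun hφ => ?_
  obtain ⟨t, ht⟩ := AddChar.ne_one_iff.1 hψ
  obtain ⟨X, hX⟩ : ∃ X : Matrix (Fin m) (Fin n) F, (C * X).trace ≠ 0 := by
    by_contra! h
    exact hC (Matrix.ext_iff_trace_mul_right.2 fun X => by simpa using h X)
  apply ht
  -- This multiple of `X` has pairing `t` with `C`, and `ψ t ≠ 1`.
  have := DFunLike.congr_fun hφ ((t / (C * X).trace) • X)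
  simpa [φ, hX] using this

theorem kloostermanFactor_mul_unipotentGL {F : Type*} [Field F] {c₁ c₂ : ℕ}
    (χ : Fˣ →* ℂˣ) (ψ : AddChar F ℂ) (x : GL (Fin (c₁ + c₂)) F)
    {A : Matrix (Fin c₁) (Fin c₁) F} {B : Matrix (Fin c₁) (Fin c₂) F}
    {C : Matrix (Fin c₂) (Fin c₁) F} {D : Matrix (Fin c₂) (Fin c₂) F}
    (hx : (x : Matrix (Fin (c₁ + c₂)) (Fin (c₁ + c₂)) F) = blockMatrix A B C D)
    (X : Matrix (Fin c₁) (Fin c₂) F) :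
    kloostermanFactor χ ψ (x * unipotentGL X) = kloostermanFactor χ ψ x * ψ (C * X).trace := by
  have hdet : Matrix.GeneralLinearGroup.det (unipotentGL X) = 1 := by
    apply Units.ext
    rw [Matrix.GeneralLinearGroup.val_det_apply, unipotentGL_val, det_blockMatrix_zero]
    simp
  rw [kloostermanFactor, kloostermanFactor, map_mul, hdet, mul_one, Units.val_mul, hx,
    unipotentGL_val, blockMatrix_mul, trace_blockMatrix, trace_blockMatrix,
    Matrix.mul_one, Matrix.mul_one, Matrix.mul_zero, Matrix.trace_add, Matrix.trace_add,
    Matrix.trace_zero, add_zero, AddChar.map_add_eq_mul, AddChar.map_add_eq_mul,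
    AddChar.map_add_eq_mul]
  ring

/-- The sum of the Kloosterman sums over a coset of the unipotent radical. -/
noncomputable def unipotentSum {F : Type*} [Field F] [Fintype F] [DecidableEq F]
    {k c₁ c₂ : ℕ} (α : Fin k → (Fˣ →* ℂˣ)) (ψ : AddChar F ℂ) (g : GL (Fin (c₁ + c₂)) F) : ℂ :=
  ∑ X : Matrix (Fin c₁) (Fin c₂) F, twistedMatrixKloosterman α ψ (g * unipotentGL X)

/-- As a class function, `K` allows the left factor to be moved to the right end, where it only
shifts the summation variable. -/
theorem unipotentSum_unipotentGL_mul {F : Type*} [Field F] [Fintype F] [DecidableEq F]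
    {k c₁ c₂ : ℕ} (α : Fin k → (Fˣ →* ℂˣ)) (ψ : AddChar F ℂ) (g : GL (Fin (c₁ + c₂)) F)
    (Y : Matrix (Fin c₁) (Fin c₂) F) :
    unipotentSum (c₁ := c₁) (c₂ := c₂) α ψ (unipotentGL Y * g) = unipotentSum α ψ g := by
  refine Fintype.sum_equiv (Equiv.addRight Y) _ _ fun X => ?_
  rw [mul_assoc, twistedMatrixKloosterman_mul_comm, mul_assoc, unipotentGL_mul]
  rfl

theorem unipotentSum_succ {F : Type*} [Field F] [Fintype F] [DecidableEq F]
    {k c₁ c₂ : ℕ} (α : Fin (k + 1) → (Fˣ →* ℂˣ)) (ψ : AddChar F ℂ)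
    (g : GL (Fin (c₁ + c₂)) F) :
    unipotentSum (c₁ := c₁) (c₂ := c₂) α ψ g = ∑ x, kloostermanFactor (α 0) ψ x *
      unipotentSum (c₁ := c₁) (c₂ := c₂) (fun j => α j.succ) ψ (x⁻¹ * g) := by
  simp only [unipotentSum, twistedMatrixKloosterman_succ α, Finset.mul_sum, mul_assoc]
  exact Finset.sum_comm

/-- Substitute `x u(Y)` for `x` in the recursion and add over all `Y`; the factor containing `x⁻¹ g`
does not notice the change. -/
theorem card_mul_unipotentSum_succ {F : Type*} [Field F] [Fintype F] [DecidableEq F]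
    {k c₁ c₂ : ℕ} (α : Fin (k + 1) → (Fˣ →* ℂˣ)) (ψ : AddChar F ℂ)
    (g : GL (Fin (c₁ + c₂)) F) :
    (Fintype.card (Matrix (Fin c₁) (Fin c₂) F) : ℂ) *
        unipotentSum (c₁ := c₁) (c₂ := c₂) α ψ g =
      ∑ x, (∑ Y : Matrix (Fin c₁) (Fin c₂) F, kloostermanFactor (α 0) ψ (x * unipotentGL Y)) *
        unipotentSum (c₁ := c₁) (c₂ := c₂) (fun j => α j.succ) ψ (x⁻¹ * g) := by
  simp only [Finset.sum_mul]
  rw [Finset.sum_comm, ← nsmul_eq_mul, ← Finset.card_univ, ← Finset.sum_const]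
  refine Finset.sum_congr rfl fun Y _ => ?_
  rw [unipotentSum_succ, ← Equiv.sum_comp (Equiv.mulRight (unipotentGL Y))]
  refine Finset.sum_congr rfl fun x _ => ?_
  rw [Equiv.coe_mulRight, mul_inv_rev, mul_assoc (unipotentGL Y)⁻¹, unipotentGL_inv,
    unipotentSum_unipotentGL_mul]

theorem sum_kloostermanFactor_mul_unipotentGL_eq_zero {F : Type*} [Field F] [Fintype F]
    {c₁ c₂ : ℕ} (χ : Fˣ →* ℂˣ) {ψ : AddChar F ℂ} (hψ : ψ ≠ 1) (x : GL (Fin (c₁ + c₂)) F)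
    (hx : ∀ (a : GL (Fin c₁) F) (b : GL (Fin c₂) F) X, x ≠ diagGL a b * unipotentGL X) :
    ∑ Y : Matrix (Fin c₁) (Fin c₂) F, kloostermanFactor χ ψ (x * unipotentGL Y) = 0 := by
  obtain ⟨A, B, C, D, h⟩ := exists_eq_blockMatrix (c₁ := c₁) (c₂ := c₂) x.val
  have hC : C ≠ 0 := by
    rintro rfl
    obtain ⟨a, b, X, hX⟩ := exists_eq_diagGL_mul_unipotentGL x A B D h
    exact hx a b X hX
  simp only [kloostermanFactor_mul_unipotentGL χ ψ x h]
  rw [← Finset.mul_sum, sum_addChar_trace_mul hψ C hC, mul_zero]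

theorem sum_prod_const_mul_mul {R ι κ τ : Type*} [CommSemiring R] [Fintype ι] [Fintype κ]
    [Fintype τ] (c : R) (f : ι → R) (g : κ → R) :
    ∑ p : ι × κ × τ, c * (f p.1 * g p.2.1) =
      Fintype.card τ * (c * ((∑ i, f i) * ∑ j, g j)) := by
  simp only [Fintype.sum_prod_type, Finset.sum_const, Finset.card_univ, nsmul_eq_mul,
    ← Finset.mul_sum]
  rw [← Finset.sum_mul]
  ring

theorem unipotentSum_diagGL {F : Type*} [Field F] [Fintype F] [DecidableEq F]
    {ψ : AddChar F ℂ} (hψ : ψ ≠ 1) {k c₁ c₂ : ℕ} (α : Fin k → (Fˣ →* ℂˣ))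
    (h₁ : GL (Fin c₁) F) (h₂ : GL (Fin c₂) F) :
    unipotentSum (c₁ := c₁) (c₂ := c₂) α ψ (diagGL h₁ h₂) =
      (Fintype.card (Matrix (Fin c₁) (Fin c₂) F) : ℂ) ^ k *
        (twistedMatrixKloosterman α ψ h₁ * twistedMatrixKloosterman α ψ h₂) := by
  induction k generalizing h₁ h₂ with
  | zero =>
    -- For `k = 0` the sum is the indicator of the identity, so only `X = 0` can contribute.
    simp only [unipotentSum, twistedMatrixKloosterman_zero, diagGL_mul_unipotentGL_eq_one,
      ite_and, Finset.sum_ite_eq', Finset.mem_univ, if_true, pow_zero, one_mul, ite_mul, zero_mul]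
  | succ k ih =>
    set N : ℂ := (Fintype.card (Matrix (Fin c₁) (Fin c₂) F) : ℂ) with hN
    have hN0 : N ≠ 0 := Nat.cast_ne_zero.2 Fintype.card_ne_zero
    let f (c : ℕ) (h a : GL (Fin c) F) : ℂ := kloostermanFactor (α 0) ψ a *
      twistedMatrixKloosterman (fun j => α j.succ) ψ (a⁻¹ * h)
    have hf (c : ℕ) (h : GL (Fin c) F) : ∑ a, f c h a = twistedMatrixKloosterman α ψ h :=
      (twistedMatrixKloosterman_succ α ψ h).symm
    -- Of the `N ^ (k + 1)`, one factor comes from the constant sum over `Y` and `N ^ k` from the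
    -- induction hypothesis.
    have hp (p : GL (Fin c₁) F × GL (Fin c₂) F × Matrix (Fin c₁) (Fin c₂) F) :
        N ^ (k + 1) * (f c₁ h₁ p.1 * f c₂ h₂ p.2.1) =
          (∑ Y : Matrix (Fin c₁) (Fin c₂) F, kloostermanFactor (α 0) ψ
            (diagGL p.1 p.2.1 * unipotentGL p.2.2 * unipotentGL Y)) *
          unipotentSum (c₁ := c₁) (c₂ := c₂) (fun j => α j.succ) ψ
            ((diagGL p.1 p.2.1 * unipotentGL p.2.2)⁻¹ * diagGL h₁ h₂) := by
      obtain ⟨a, b, X⟩ := p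
      simp only [mul_assoc (diagGL a b), unipotentGL_mul,
        kloostermanFactor_diagGL_mul_unipotentGL, Finset.sum_const, Finset.card_univ, nsmul_eq_mul,
        mul_inv_rev, ← hN, f]
      rw [unipotentGL_inv, mul_assoc (unipotentGL _), unipotentSum_unipotentGL_mul, diagGL_inv,
        diagGL_mul, ih]
      ring
    have hsum := Fintype.sum_of_injective _
      (diagGL_mul_unipotentGL_injective (F := F) (c₁ := c₁) (c₂ := c₂)) _
      (fun x => (∑ Y : Matrix (Fin c₁) (Fin c₂) F,
          kloostermanFactor (α 0) ψ (x * unipotentGL Y)) *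
        unipotentSum (c₁ := c₁) (c₂ := c₂) (fun j => α j.succ) ψ (x⁻¹ * diagGL h₁ h₂))
      (fun x hx => by
        rw [sum_kloostermanFactor_mul_unipotentGL_eq_zero _ hψ, zero_mul]
        exact fun a b X h => hx ⟨(a, b, X), h.symm⟩) hp
    apply mul_left_cancel₀ hN0
    -- The terms do not depend on the coordinate `X` of the triple; summing over it gives the `N`
    -- that cancels the one from averaging.
    rw [hN, card_mul_unipotentSum_succ, ← hsum, sum_prod_const_mul_mul, hf, hf]

/-! ### The Sylvester equation and conjugacy within the coset -/

/-- Matrices without common eigenvalue have only the zero matrix as intertwiner. -/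
theorem eq_zero_of_mul_eq_mul {F : Type*} [Field F] {c₁ c₂ : ℕ}
    {A : Matrix (Fin c₁) (Fin c₁) F} {B : Matrix (Fin c₂) (Fin c₂) F}
    (hAB : ¬ HaveCommonEigenvalue A B) {X : Matrix (Fin c₁) (Fin c₂) F} (hX : A * X = X * B) :
    X = 0 := by
  have hcop : IsCoprime A.charpoly B.charpoly := by
    rw [Polynomial.isCoprime_iff_aeval_ne_zero_of_isAlgClosed F (AlgebraicClosure F)]
    by_contra! ⟨μ, hA, hB⟩
    refine hAB ⟨μ, ?_, ?_⟩
    · rwa [Module.End.hasEigenvalue_iff_isRoot_charpoly, Matrix.charpoly_toLin',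
        Matrix.charpoly_map, Polynomial.IsRoot, Polynomial.eval_map_algebraMap]
    · rwa [Module.End.hasEigenvalue_iff_isRoot_charpoly, Matrix.charpoly_toLin',
        Matrix.charpoly_map, Polynomial.IsRoot, Polynomial.eval_map_algebraMap]
  have hp : ∀ p : Polynomial F, Polynomial.aeval A p * X = X * Polynomial.aeval B p := by
    intro p
    induction p using Polynomial.induction_on' with
    | add p q hp hq => rw [map_add, map_add, Matrix.add_mul, Matrix.mul_add, hp, hq]
    | monomial n a =>
      have hn : A ^ n * X = X * B ^ n := by
        induction n with
        | zero => simp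
        | succ n ih =>
          rw [pow_succ, Matrix.mul_assoc, hX, ← Matrix.mul_assoc, ih, Matrix.mul_assoc, pow_succ]
      simp only [Polynomial.aeval_monomial, Algebra.algebraMap_eq_smul_one, smul_mul_assoc,
        one_mul, Matrix.smul_mul, Matrix.mul_smul, hn]
  obtain ⟨u, v, huv⟩ := hcop
  -- At `A` the Bézout identity loses its `A.charpoly` term; in the other, moving `B.charpoly`
  -- across `X` turns it into its value at `B`, which is zero.
  have h := congrArg (Polynomial.aeval A) huv
  rw [map_add, map_mul, map_mul, map_one, Matrix.aeval_self_charpoly, mul_zero, zero_add] at h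
  rw [← Matrix.one_mul X, ← h, Matrix.mul_assoc, hp, Matrix.aeval_self_charpoly, Matrix.mul_zero,
    Matrix.mul_zero]

/-- The upper right blocks are `h₁ Y` and `h₁ X - X h₂`, so a Sylvester equation must be solved; in
finite dimension injectivity suffices. -/
theorem exists_diagGL_mul_unipotentGL_eq_conj {F : Type*} [Field F] {c₁ c₂ : ℕ}
    (h₁ : GL (Fin c₁) F) (h₂ : GL (Fin c₂) F)
    (h : ¬ HaveCommonEigenvalue (h₁ : Matrix (Fin c₁) (Fin c₁) F)
      (h₂ : Matrix (Fin c₂) (Fin c₂) F)) (Y : Matrix (Fin c₁) (Fin c₂) F) :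
    ∃ X : Matrix (Fin c₁) (Fin c₂) F,
      diagGL h₁ h₂ * unipotentGL Y = unipotentGL (-X) * diagGL h₁ h₂ * unipotentGL X := by
  let L : Matrix (Fin c₁) (Fin c₂) F →ₗ[F] Matrix (Fin c₁) (Fin c₂) F :=
    { toFun := fun X => h₁.val * X - X * h₂.val
      map_add' := fun X Y => by rw [Matrix.mul_add, Matrix.add_mul]; abel
      map_smul' := fun r X => by simp [smul_sub] }
  have hL : Function.Injective L := (injective_iff_map_eq_zero L).2 fun X hX =>
    eq_zero_of_mul_eq_mul h (sub_eq_zero.1 hX)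
  obtain ⟨X, hX⟩ := LinearMap.injective_iff_surjective.1 hL (h₁.val * Y)
  have hX' : h₁.val * X - X * h₂.val = h₁.val * Y := hX
  refine ⟨X, Units.ext ?_⟩
  simp only [Units.val_mul, diagGL_val, unipotentGL_val, blockMatrix_mul, blockMatrix_inj]
  simp [← hX', sub_eq_add_neg]

theorem unipotentSum_diagGL_of_not_haveCommonEigenvalue {F : Type*} [Field F] [Fintype F]
    [DecidableEq F] (ψ : AddChar F ℂ) {k c₁ c₂ : ℕ} (α : Fin k → (Fˣ →* ℂˣ))
    (h₁ : GL (Fin c₁) F) (h₂ : GL (Fin c₂) F)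
    (h : ¬ HaveCommonEigenvalue (h₁ : Matrix (Fin c₁) (Fin c₁) F)
      (h₂ : Matrix (Fin c₂) (Fin c₂) F)) :
    unipotentSum (c₁ := c₁) (c₂ := c₂) α ψ (diagGL h₁ h₂) =
      (Fintype.card (Matrix (Fin c₁) (Fin c₂) F) : ℂ) *
        twistedMatrixKloosterman α ψ (diagGL h₁ h₂) := by
  rw [unipotentSum, ← nsmul_eq_mul, ← Finset.card_univ, ← Finset.sum_const]
  refine Finset.sum_congr rfl fun Y _ => ?_
  obtain ⟨X, hX⟩ := exists_diagGL_mul_unipotentGL_eq_conj h₁ h₂ h Y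
  rw [hX, twistedMatrixKloosterman_mul_comm, ← unipotentGL_inv, mul_inv_cancel_left]

/-! ### Deduction of the two identities -/

/-- Block matrices `1 X; 0 1` parametrise the unipotent radical. -/
noncomputable def matrixEquivUnipotentRadical (F : Type*) [Field F] (c₁ c₂ : ℕ) :
    Matrix (Fin c₁) (Fin c₂) F ≃ unipotentRadical F c₁ c₂ :=
  Equiv.ofBijective (fun X => ⟨unipotentGL X, X, rfl⟩)
    ⟨fun X Y h => by
      have h' : blockMatrix 1 X 0 1 = blockMatrix 1 Y 0 1 :=
        congrArg (fun n : unipotentRadical F c₁ c₂ => n.val.val) h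
      exact (blockMatrix_inj.1 h').2.1,
    fun ⟨n, X, hX⟩ => ⟨X, Subtype.ext (Units.ext hX.symm)⟩⟩

theorem card_matrix_pow {F : Type*} [Fintype F] (k c₁ c₂ : ℕ) :
    (Fintype.card (Matrix (Fin c₁) (Fin c₂) F) : ℂ) ^ k =
      (Fintype.card F : ℂ) ^ (k * c₁ * c₂) := by
  have h : Fintype.card (Matrix (Fin c₁) (Fin c₂) F) = Fintype.card F ^ (c₁ * c₂) := by
    rw [← Nat.card_eq_fintype_card, ← Nat.card_eq_fintype_card, Matrix, Nat.card_fun, Nat.card_fun]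
    simp [← pow_mul, mul_comm]
  rw [h, Nat.cast_pow, ← pow_mul, mul_comm _ k, mul_assoc]

open scoped Classical in
theorem mainTheorem6 {F : Type*} [Field F] [Fintype F] [DecidableEq F]
    (ψ : AddChar F ℂ) (hψ : ψ ≠ 1)
    (k : ℕ) (hk : 1 ≤ k) (α : Fin k → (Fˣ →* ℂˣ))
    (c₁ c₂ : ℕ) (h₁ : GL (Fin c₁) F) (h₂ : GL (Fin c₂) F) :
    (∑ n : unipotentRadical F c₁ c₂,
        twistedMatrixKloosterman α ψ ((n : GL (Fin (c₁ + c₂)) F) * diagGL h₁ h₂) =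
      (Fintype.card F : ℂ) ^ (k * c₁ * c₂) *
        twistedMatrixKloosterman α ψ h₁ * twistedMatrixKloosterman α ψ h₂) ∧
    (¬ HaveCommonEigenvalue (h₁ : Matrix (Fin c₁) (Fin c₁) F)
        (h₂ : Matrix (Fin c₂) (Fin c₂) F) →
      twistedMatrixKloosterman α ψ (diagGL h₁ h₂) =
        (Fintype.card F : ℂ) ^ ((k - 1) * c₁ * c₂) *
          twistedMatrixKloosterman α ψ h₁ * twistedMatrixKloosterman α ψ h₂) := by
  have hsum := unipotentSum_diagGL hψ α h₁ h₂
  refine ⟨?_, fun h => ?_⟩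
  · rw [mul_assoc, ← card_matrix_pow, ← hsum, unipotentSum,
      ← (matrixEquivUnipotentRadical F c₁ c₂).sum_comp]
    -- The unipotent factor stands on the left here and on the right in `unipotentSum`.
    exact Finset.sum_congr rfl fun X _ => twistedMatrixKloosterman_mul_comm α ψ _ _
  · rw [unipotentSum_diagGL_of_not_haveCommonEigenvalue ψ α h₁ h₂ h] at hsum
    -- The constant coset sum contributes one factor `|Mat|`; cancelling it lowers the exponent from
    -- `k` to `k - 1`.
    obtain ⟨k, rfl⟩ := Nat.exists_eq_add_of_le' hk
    rw [Nat.add_sub_cancel, mul_assoc, ← card_matrix_pow]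
    refine mul_left_cancel₀ (Nat.cast_ne_zero.2 (Fintype.card_ne_zero
      (α := Matrix (Fin c₁) (Fin c₂) F))) (hsum.trans ?_)
    rw [pow_succ', mul_assoc]
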